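/- An MV-algebra is an algebra $(A;\oplus,{}^*,0,1)$ such that $(A;\oplus,0)$ is a commutative monoid and, for all $x,y\in A$, $x^{**}=x$, $x\oplus 1=1$ and $x\oplus(x\oplus y^*)^*=y\oplus(y\oplus x^*)^*$. An EMV-algebra is an algebra $(M;\vee,\wedge,\oplus,0)$ such that (i) $(M;\vee,\wedge,0)$ is a distributive lattice with least element $0$; (ii) $(M;\oplus,0)$ is a commutative ordered monoid with neutral element $0$ (that is, $x\le y$ implies $x\oplus z\le y\oplus z$); (iii) for each idempotent $a$ (i.e. $a\oplus a=a$), the element $\lambda_a(x)=\min\{z\in[0,a] : z\oplus x=a\}$ exists for every $x\in[0,a]$ and $([0,a];\oplus,\lambda_a,0,a)$ is an MV-algebra; (iv) each $x\in M$ lies below some idempotent. $M$ is $\sigma$-complete if every sequence in $M$ has a least upper bound in $M$. The set $\mathcal I(M)$ of idempotents of $M$, with the operations inherited from $M$, is an EMV-algebra (in fact a generalized Boolean algebra). A $\sigma$-ring of subsets of a non-empty set $\Omega$ is a system $\mathcal R$ of subsets of $\Omega$ with $\emptyset\in\mathcal R$ that is closed under finite unions, differences and countable unions; it is an EMV-algebra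 with $\oplus=\vee=\cup$, $\wedge=\cap$, $0=\emptyset$ (so $\lambda_B(A)=B\setminus A$ for $A\subseteq B$). An EMV-homomorphism is a map $f$ between EMV-algebras that preserves $\vee,\wedge,\oplus,0$ and satisfies $f(\lambda_b(x))=\lambda_{f(b)}(f(x))$ for every idempotent $b$ and every $x\le b$. It is a $\sigma$-homomorphism if, whenever a sequence $(x_n)$ has a supremum $x$ in the domain, $\bigvee_n f(x_n)$ exists in the codomain and equals $f(x)$. **Corollary.** Let $M$ be a $\sigma$-complete EMV-algebra. Then there are a $\sigma$-ring $\mathcal R$ of subsets of some set $\Omega\neq\emptyset$ and a surjective $\sigma$-homomorphism (of EMV-algebras) from $\mathcal R$ onto $\mathcal I(M)$. -/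

import Mathlib

universe u

/-- The set `S` is closed under `op`, `star`, contains `zero` and `one`, and
`(S; op, star, zero, one)` is an MV-algebra. -/
structure IsMVAlgebraOn {M : Type u} (S : Set M) (op : M → M → M) (star : M → M)
    (zero one : M) : Prop where
  op_mem : ∀ x ∈ S, ∀ y ∈ S, op x y ∈ S
  star_mem : ∀ x ∈ S, star x ∈ S
  zero_mem : zero ∈ S
  one_mem : one ∈ S
  op_assoc : ∀ x ∈ S, ∀ y ∈ S, ∀ z ∈ S, op (op x y) z = op x (op y z)
  op_comm : ∀ x ∈ S, ∀ y ∈ S, op x y = op y x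
  op_zero : ∀ x ∈ S, op x zero = x
  star_star : ∀ x ∈ S, star (star x) = x
  op_one : ∀ x ∈ S, op x one = one
  op_star : ∀ x ∈ S, ∀ y ∈ S,
    op x (star (op x (star y))) = op y (star (op y (star x)))

/-- `emvCompl a x` is the relative complement `λ_a(x) = min {z ∈ [0,a] | z ⊕ x = a}`
(with `⊕` written `+`); a junk value if the minimum does not exist. -/
noncomputable def emvCompl {M : Type u} [Zero M] [Add M] [Preorder M] (a x : M) : M :=
  @Classical.epsilon M ⟨0⟩ (fun w => IsLeast {z : M | 0 ≤ z ∧ z ≤ a ∧ z + x = a} w)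

/-- EMV-algebras `(M; ∨, ∧, ⊕, 0)`; the operation `⊕` is written `+`. -/
class EMVAlgebra (M : Type u) extends AddCommMonoid M, DistribLattice M where
  zero_le' : ∀ x : M, 0 ≤ x
  oplus_mono : ∀ x y z : M, x ≤ y → x + z ≤ y + z
  compl_isLeast : ∀ a : M, a + a = a → ∀ x ∈ Set.Icc 0 a,
    IsLeast {z : M | 0 ≤ z ∧ z ≤ a ∧ z + x = a} (emvCompl a x)
  isMV : ∀ a : M, a + a = a →
    IsMVAlgebraOn (Set.Icc 0 a) (fun x y => x + y) (emvCompl a) 0 a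
  exists_idem : ∀ x : M, ∃ a : M, a + a = a ∧ x ≤ a

/-- Every sequence has a least upper bound. -/
def EMVAlgebra.IsSigmaComplete (M : Type u) [EMVAlgebra M] : Prop :=
  ∀ x : ℕ → M, ∃ s : M, IsLUB (Set.range x) s

/-- EMV-homomorphisms. -/
structure IsEMVHom {M₁ M₂ : Type*} [EMVAlgebra M₁] [EMVAlgebra M₂] (f : M₁ → M₂) : Prop where
  map_sup : ∀ x y, f (x ⊔ y) = f x ⊔ f y
  map_inf : ∀ x y, f (x ⊓ y) = f x ⊓ f y
  map_oplus : ∀ x y, f (x + y) = f x + f y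
  map_zero : f 0 = 0
  map_compl : ∀ b : M₁, b + b = b → ∀ x ≤ b, f (emvCompl b x) = emvCompl (f b) (f x)

/-- σ-homomorphisms: EMV-homomorphisms that preserve all existing countable suprema. -/
structure IsSigmaEMVHom {M₁ M₂ : Type*} [EMVAlgebra M₁] [EMVAlgebra M₂] (f : M₁ → M₂) : Prop
    extends IsEMVHom f where
  map_iSup : ∀ (x : ℕ → M₁) (s : M₁),
    IsLUB (Set.range x) s → IsLUB (Set.range fun n => f (x n)) (f s)

theorem emvCompl_eq_of_isLeast {M : Type u} [Zero M] [Add M] [PartialOrder M] {a x w : M}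
    (h : IsLeast {z : M | 0 ≤ z ∧ z ≤ a ∧ z + x = a} w) : emvCompl a x = w :=
  IsLeast.unique (Classical.epsilon_spec
    (p := fun w => IsLeast {z : M | 0 ≤ z ∧ z ≤ a ∧ z + x = a} w) ⟨w, h⟩) h

namespace EMVAlgebra

/-- The idempotents `I(M)` of `M`. -/
def Idem (M : Type u) [EMVAlgebra M] : Type u := {a : M // a + a = a}

section
variable {M : Type u} [EMVAlgebra M]

theorem le_oplus (x y : M) : x ≤ x + y := by
  have h := oplus_mono 0 y x (zero_le' y)
  rwa [zero_add, add_comm] at h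

theorem idem_oplus_eq {a v : M} (ha : a + a = a) (hv : a ≤ v) : a + v = v := by
  obtain ⟨c, hc, hvc⟩ := exists_idem v
  have hM := isMV c hc
  have hac : a ∈ Set.Icc 0 c := ⟨zero_le' a, hv.trans hvc⟩
  have hvc' : v ∈ Set.Icc 0 c := ⟨zero_le' v, hvc⟩
  have h1 := hM.op_star a hac v hvc'
  have h2 : v + emvCompl c a = c := by
    have h := (compl_isLeast c hc a hac).1.2.2
    apply le_antisymm (hM.op_mem v hvc' _ (hM.star_mem a hac)).2
    calc c = a + emvCompl c a := by rw [add_comm]; exact h.symm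
      _ ≤ _ := oplus_mono _ _ _ hv
  have h3 : emvCompl c c = 0 := by
    apply emvCompl_eq_of_isLeast
    exact ⟨⟨le_rfl, zero_le' c, zero_add c⟩, fun z _ => zero_le' z⟩
  simp only [h2, h3, add_zero] at h1
  calc a + v = a + (a + emvCompl c (a + emvCompl c v)) := by rw [h1]
    _ = v := by rw [← add_assoc, ha, h1]

theorem idem_sup_eq {a b : M} (ha : a + a = a) (hb : b + b = b) : a ⊔ b = a + b := by
  apply le_antisymm (sup_le (le_oplus a b) (by rw [add_comm]; exact le_oplus b a))
  have h : a + b + (a ⊔ b) = a ⊔ b := by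
    rw [add_assoc, idem_oplus_eq hb le_sup_right, idem_oplus_eq ha le_sup_left]
  exact (le_oplus (a + b) (a ⊔ b)).trans h.le

theorem idem_oplus {a b : M} (ha : a + a = a) (hb : b + b = b) :
    (a + b) + (a + b) = a + b := by
  rw [add_add_add_comm, ha, hb]

theorem idem_sup {a b : M} (ha : a + a = a) (hb : b + b = b) :
    (a ⊔ b) + (a ⊔ b) = a ⊔ b := by
  rw [idem_sup_eq ha hb, idem_oplus ha hb]

theorem oplus_mono₂ {x y z w : M} (h : x ≤ y) (h' : z ≤ w) : x + z ≤ y + w := by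
  refine (oplus_mono x y z h).trans ?_
  rw [add_comm y, add_comm y]
  exact oplus_mono z w y h'

theorem idem_inf {a b : M} (ha : a + a = a) (hb : b + b = b) :
    (a ⊓ b) + (a ⊓ b) = a ⊓ b := by
  refine le_antisymm (le_inf ?_ ?_) (le_oplus _ _)
  · exact (oplus_mono₂ inf_le_left inf_le_left).trans ha.le
  · exact (oplus_mono₂ inf_le_right inf_le_right).trans hb.le

theorem idem_compl {a b : M} (ha : a + a = a) (hb : b + b = b) (hab : b ≤ a) :
    emvCompl a b + emvCompl a b = emvCompl a b := by
  have hM := isMV a ha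
  have hbm : b ∈ Set.Icc 0 a := ⟨zero_le' b, hab⟩
  have hcm := hM.star_mem b hbm
  have hwm := hM.op_mem _ hcm _ hcm
  have h1 := hM.op_star b hbm (emvCompl a b) hcm
  have h2 := (compl_isLeast a ha b hbm).1.2.2
  simp only [hM.star_star b hbm, hb] at h1
  rw [add_comm, h2] at h1
  refine le_antisymm ?_ (le_oplus _ _)
  have h3 := (compl_isLeast a ha _ (hM.star_mem _ hwm)).2
    (show emvCompl a b ∈ _ from ⟨hcm.1, hcm.2, h1.symm⟩)
  simpa only [hM.star_star _ hwm] using h3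

namespace Idem

instance : Zero (Idem M) where
  zero := ⟨0, add_zero 0⟩

instance : Add (Idem M) where
  add a b := ⟨a.1 + b.1, idem_oplus a.2 b.2⟩

instance : AddCommMonoid (Idem M) where
  add_assoc a b c := Subtype.ext (add_assoc a.1 b.1 c.1)
  zero_add a := Subtype.ext (zero_add a.1)
  add_zero a := Subtype.ext (add_zero a.1)
  add_comm a b := Subtype.ext (add_comm a.1 b.1)
  nsmul := nsmulRec

instance : DistribLattice (Idem M) where
  le a b := a.1 ≤ b.1
  le_refl a := le_refl a.1
  le_trans a b c := le_trans (a := a.1) (b := b.1) (c := c.1)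
  le_antisymm a b h h' := Subtype.ext (le_antisymm h h')
  sup a b := ⟨a.1 ⊔ b.1, idem_sup a.2 b.2⟩
  inf a b := ⟨a.1 ⊓ b.1, idem_inf a.2 b.2⟩
  le_sup_left a b := le_sup_left (a := a.1) (b := b.1)
  le_sup_right a b := le_sup_right (a := a.1) (b := b.1)
  sup_le a b c h h' := sup_le (a := a.1) (b := b.1) (c := c.1) h h'
  inf_le_left a b := inf_le_left (a := a.1) (b := b.1)
  inf_le_right a b := inf_le_right (a := a.1) (b := b.1)
  le_inf a b c h h' := le_inf (c := a.1) (a := b.1) (b := c.1) h h'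
  le_sup_inf a b c := le_sup_inf (x := a.1) (y := b.1) (z := c.1)

theorem compl_isLeast_aux (a x : Idem M) (hx : x ≤ a) :
    IsLeast {z : Idem M | 0 ≤ z ∧ z ≤ a ∧ z + x = a}
      ⟨emvCompl a.1 x.1, idem_compl a.2 x.2 hx⟩ := by
  have h := compl_isLeast a.1 a.2 x.1 ⟨zero_le' x.1, hx⟩
  exact ⟨⟨h.1.1, h.1.2.1, Subtype.ext h.1.2.2⟩,
    fun z hz => h.2 ⟨hz.1, hz.2.1, congrArg Subtype.val hz.2.2⟩⟩

theorem coe_compl (a x : Idem M) (hx : x ≤ a) : (emvCompl a x).1 = emvCompl a.1 x.1 := by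
  rw [emvCompl_eq_of_isLeast (compl_isLeast_aux a x hx)]

/-- `I(M)` with the operations inherited from `M`. -/
instance : EMVAlgebra (Idem M) where
  zero_le' x := zero_le' x.1
  oplus_mono x y z h := oplus_mono x.1 y.1 z.1 h
  compl_isLeast a _ x hx := by
    rw [emvCompl_eq_of_isLeast (compl_isLeast_aux a x hx.2)]
    exact compl_isLeast_aux a x hx.2
  isMV a _ := by
    have hM := isMV a.1 a.2
    have hop : ∀ x ∈ Set.Icc 0 a, ∀ y ∈ Set.Icc 0 a, x + y ∈ Set.Icc 0 a :=
      fun x hx y hy => hM.op_mem x.1 hx y.1 hy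
    have hst : ∀ x ∈ Set.Icc 0 a, emvCompl a x ∈ Set.Icc 0 a := by
      intro x hx
      rw [emvCompl_eq_of_isLeast (compl_isLeast_aux a x hx.2)]
      exact hM.star_mem x.1 hx
    refine ⟨hop, hst, ⟨le_rfl, zero_le' a.1⟩, ⟨zero_le' a.1, le_rfl⟩,
      fun x _ y _ z _ => add_assoc x y z, fun x _ y _ => add_comm x y,
      fun x _ => add_zero x, ?_, fun x hx => Subtype.ext (hM.op_one x.1 hx), ?_⟩
    · intro x hx
      apply Subtype.ext
      rw [coe_compl _ _ (hst x hx).2, coe_compl _ _ hx.2]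
      exact hM.star_star x.1 hx
    · intro x hx y hy
      apply Subtype.ext
      change x.1 + (emvCompl a (x + emvCompl a y)).1 = y.1 + (emvCompl a (y + emvCompl a x)).1
      rw [coe_compl _ _ (hop _ hx _ (hst _ hy)).2, coe_compl _ _ (hop _ hy _ (hst _ hx)).2]
      change x.1 + (emvCompl a.1 (x.1 + (emvCompl a y).1)) =
        y.1 + (emvCompl a.1 (y.1 + (emvCompl a x).1))
      rw [coe_compl _ _ hx.2, coe_compl _ _ hy.2]
      exact hM.op_star x.1 hx y.1 hy
  exists_idem x := ⟨x, Subtype.ext x.2, le_rfl⟩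

end Idem
end
end EMVAlgebra

/-- σ-rings of subsets of `Ω`. -/
structure SigmaRing (Ω : Type u) where
  carrier : Set (Set Ω)
  isSetRing : MeasureTheory.IsSetRing carrier
  iUnion_mem : ∀ A : ℕ → Set Ω, (∀ n, A n ∈ carrier) → (⋃ n, A n) ∈ carrier

namespace SigmaRing

/-- The members of the σ-ring, as a type. -/
def Elem {Ω : Type u} (R : SigmaRing Ω) : Type u := {A : Set Ω // A ∈ R.carrier}

section
variable {Ω : Type u} {R : SigmaRing Ω}

instance : Zero R.Elem where
  zero := ⟨∅, R.isSetRing.empty_mem⟩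

instance : Add R.Elem where
  add A B := ⟨A.1 ∪ B.1, R.isSetRing.union_mem A.2 B.2⟩

instance : AddCommMonoid R.Elem where
  add_assoc A B C := Subtype.ext (Set.union_assoc A.1 B.1 C.1)
  zero_add A := Subtype.ext (Set.empty_union A.1)
  add_zero A := Subtype.ext (Set.union_empty A.1)
  add_comm A B := Subtype.ext (Set.union_comm A.1 B.1)
  nsmul := nsmulRec

instance : DistribLattice R.Elem where
  le A B := A.1 ⊆ B.1
  le_refl A := le_refl A.1
  le_trans A B C := le_trans (a := A.1) (b := B.1) (c := C.1)
  le_antisymm A B h h' := Subtype.ext (le_antisymm h h')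
  sup A B := ⟨A.1 ∪ B.1, R.isSetRing.union_mem A.2 B.2⟩
  inf A B := ⟨A.1 ∩ B.1, R.isSetRing.inter_mem A.2 B.2⟩
  le_sup_left A B := le_sup_left (a := A.1) (b := B.1)
  le_sup_right A B := le_sup_right (a := A.1) (b := B.1)
  sup_le A B C h h' := sup_le (a := A.1) (b := B.1) (c := C.1) h h'
  inf_le_left A B := inf_le_left (a := A.1) (b := B.1)
  inf_le_right A B := inf_le_right (a := A.1) (b := B.1)
  le_inf A B C h h' := le_inf (c := A.1) (a := B.1) (b := C.1) h h'
  le_sup_inf A B C := le_sup_inf (x := A.1) (y := B.1) (z := C.1)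

theorem compl_isLeast_aux (A X : R.Elem) (hX : X ≤ A) :
    IsLeast {Z : R.Elem | 0 ≤ Z ∧ Z ≤ A ∧ Z + X = A}
      ⟨A.1 \ X.1, R.isSetRing.sdiff_mem A.2 X.2⟩ := by
  refine ⟨⟨Set.empty_subset _, Set.sdiff_subset, Subtype.ext (Set.sdiff_union_of_subset hX)⟩, ?_⟩
  intro Z hZ
  have h : Z.1 ∪ X.1 = A.1 := congrArg Subtype.val hZ.2.2
  intro p hp
  have hp' : p ∈ Z.1 ∪ X.1 := by rw [h]; exact hp.1
  exact hp'.resolve_right hp.2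

theorem coe_compl (A X : R.Elem) (hX : X ≤ A) : (emvCompl A X).1 = A.1 \ X.1 := by
  rw [emvCompl_eq_of_isLeast (compl_isLeast_aux A X hX)]

/-- A σ-ring with `⊕ = ∨ = ∪`, `∧ = ∩` and `0 = ∅`. -/
instance : EMVAlgebra R.Elem where
  zero_le' X := Set.empty_subset X.1
  oplus_mono X Y Z h := Set.union_subset_union_left Z.1 h
  compl_isLeast A _ X hX := by
    rw [emvCompl_eq_of_isLeast (compl_isLeast_aux A X hX.2)]
    exact compl_isLeast_aux A X hX.2
  isMV A _ := by
    have hop : ∀ X ∈ Set.Icc 0 A, ∀ Y ∈ Set.Icc 0 A, X + Y ∈ Set.Icc 0 A :=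
      fun X hX Y hY => ⟨Set.empty_subset _, Set.union_subset hX.2 hY.2⟩
    have hst : ∀ X ∈ Set.Icc 0 A, emvCompl A X ∈ Set.Icc 0 A := by
      intro X hX
      rw [emvCompl_eq_of_isLeast (compl_isLeast_aux A X hX.2)]
      exact ⟨Set.empty_subset _, Set.sdiff_subset⟩
    refine ⟨hop, hst, ⟨le_rfl, Set.empty_subset _⟩, ⟨Set.empty_subset _, le_rfl⟩,
      fun X _ Y _ Z _ => add_assoc X Y Z, fun X _ Y _ => add_comm X Y,
      fun X _ => add_zero X, ?_, fun X hX => Subtype.ext (Set.union_eq_self_of_subset_left hX.2),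
      ?_⟩
    · intro X hX
      apply Subtype.ext
      rw [coe_compl _ _ (hst X hX).2, coe_compl _ _ hX.2]
      exact Set.sdiff_sdiff_cancel_left hX.2
    · intro X hX Y hY
      apply Subtype.ext
      change X.1 ∪ (emvCompl A (X + emvCompl A Y)).1 = Y.1 ∪ (emvCompl A (Y + emvCompl A X)).1
      rw [coe_compl _ _ (hop _ hX _ (hst _ hY)).2, coe_compl _ _ (hop _ hY _ (hst _ hX)).2]
      change X.1 ∪ (A.1 \ (X.1 ∪ (emvCompl A Y).1)) = Y.1 ∪ (A.1 \ (Y.1 ∪ (emvCompl A X).1))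
      rw [coe_compl _ _ hX.2, coe_compl _ _ hY.2]
      have h1 : X.1 ⊆ A.1 := hX.2
      have h2 : Y.1 ⊆ A.1 := hY.2
      ext p
      have h1p := @h1 p
      have h2p := @h2 p
      simp only [Set.mem_union, Set.mem_sdiff]
      tauto
  exists_idem X := ⟨X, Subtype.ext (Set.union_self X.1), le_rfl⟩

end
end SigmaRing

/-! ### The idempotents form a σ-complete generalized Boolean algebra -/

namespace EMVAlgebra

section
variable {M : Type u} [EMVAlgebra M]

/-! The idempotents form a generalized Boolean algebra `B` closed under the countable suprema of
`M`, so the claim is a Loomis–Sikorski theorem for `B`. Points are proper filters, not ultrafilters: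
`basic` then respects meets exactly, but joins and differences only up to a set of filters missing
some countable supremum. Such sets generate the σ-ideal `IsNull`. A Rasiowa–Sikorski construction
(`eq_bot_of_isNull_basic`) shows that no nonzero `b` has null `basic b`. Hence a set agrees with
`basic b` modulo null sets for at most one `b`. The sets that do so for some `b` form the σ-ring,
and sending each to its `b` is the required map. -/

theorem compl_antitone {c x y : M} (hc : c + c = c) (hxy : x ≤ y) (hy : y ≤ c) :
    emvCompl c y ≤ emvCompl c x := by
  have hM := isMV c hc
  have hx' : x ∈ Set.Icc 0 c := ⟨zero_le' x, hxy.trans hy⟩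
  have hy' : y ∈ Set.Icc 0 c := ⟨zero_le' y, hy⟩
  have hs := hM.star_mem x hx'
  refine (compl_isLeast c hc y hy').2 ⟨hs.1, hs.2, le_antisymm (hM.op_mem _ hs _ hy').2 ?_⟩
  exact (compl_isLeast c hc x hx').1.2.2.ge.trans (oplus_mono₂ le_rfl hxy)

/-- A least upper bound of idempotents is idempotent. -/
theorem idem_of_isLUB {ι : Type*} {a : ι → M} (ha : ∀ i, a i + a i = a i) {s : M}
    (hs : IsLUB (Set.range a) s) : s + s = s := by
  obtain ⟨c, hc, hsc⟩ := exists_idem s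
  have hM := isMV c hc
  have has : ∀ i, a i ≤ s := fun i => hs.1 ⟨i, rfl⟩
  have hs' : s ∈ Set.Icc 0 c := ⟨zero_le' s, hsc⟩
  have ht := hM.star_mem s hs'
  have htt := hM.op_mem _ ht _ ht
  -- With `t` the complement of `s` in `c`, `t` lies below the idempotent complement of each `a i`,
  -- hence so does `t + t`. Complementing bounds every `a i`, hence `s`, and gives `t + t ≤ t`; then
  -- `s` is the complement of an idempotent.
  have key : s ≤ emvCompl c (emvCompl c s + emvCompl c s) := by
    refine hs.2 ?_
    rintro _ ⟨i, rfl⟩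
    have hi : a i ∈ Set.Icc 0 c := ⟨zero_le' _, (has i).trans hsc⟩
    have h1 := compl_antitone hc (has i) hsc
    have h2 : emvCompl c s + emvCompl c s ≤ emvCompl c (a i) :=
      (oplus_mono₂ h1 h1).trans (idem_compl hc (ha i) hi.2).le
    have h3 := compl_antitone hc h2 (hM.star_mem _ hi).2
    rwa [hM.star_star _ hi] at h3
  have h4 := compl_antitone hc key (hM.star_mem _ htt).2
  rw [hM.star_star _ htt] at h4
  have h5 := idem_compl hc (le_antisymm h4 (le_oplus _ _)) ht.2
  rwa [hM.star_star s hs'] at h5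

namespace Idem

theorem exists_isLUB (hM : IsSigmaComplete M) (a : ℕ → Idem M) :
    ∃ s, IsLUB (Set.range a) s := by
  obtain ⟨s, hs⟩ := hM fun n => (a n).1
  refine ⟨⟨s, idem_of_isLUB (fun n => (a n).2) hs⟩, ?_, fun t ht => hs.2 ?_⟩
  · rintro _ ⟨n, rfl⟩
    exact hs.1 ⟨n, rfl⟩
  · rintro _ ⟨n, rfl⟩
    exact ht ⟨n, rfl⟩

theorem add_eq_sup (a b : Idem M) : a + b = a ⊔ b :=
  Subtype.ext (idem_sup_eq a.2 b.2).symm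

theorem compl_sup {a x : Idem M} (hx : x ≤ a) : emvCompl a x ⊔ x = a := by
  rw [← add_eq_sup]
  exact (compl_isLeast a (Subtype.ext a.2) x ⟨zero_le' x, hx⟩).1.2.2

/-- Minimality of the complement `l` forces disjointness: removing `l ⊓ x` from `l` still leaves a
complement of `x`, so nothing was removed. -/
theorem compl_inf {a x : Idem M} (hx : x ≤ a) : emvCompl a x ⊓ x = 0 := by
  have hl := compl_isLeast a (Subtype.ext a.2) x ⟨zero_le' x, hx⟩
  generalize emvCompl a x = l at hl ⊢
  have hM := isMV l (Subtype.ext l.2)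
  have hw : l ⊓ x ∈ Set.Icc 0 l := ⟨zero_le' _, inf_le_left⟩
  have hz := hM.star_mem _ hw
  have h1 : l ≤ emvCompl l (l ⊓ x) := by
    refine hl.2 ⟨zero_le' _, hz.2.trans hl.1.2.1, ?_⟩
    have h2 := hl.1.2.2
    rw [add_eq_sup] at h2 ⊢
    refine le_antisymm (sup_le (hz.2.trans hl.1.2.1) hx) (h2.ge.trans (sup_le ?_ le_sup_right))
    exact (compl_sup inf_le_left).ge.trans (sup_le_sup_left inf_le_right _)
  rw [← hM.star_star _ hw, le_antisymm hz.2 h1]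
  refine emvCompl_eq_of_isLeast ⟨⟨le_rfl, zero_le' _, zero_add _⟩, fun z _ => zero_le' z⟩

/-- Relative complements are only meaningful below `a`, hence the cut to `a ⊓ b`. -/
noncomputable instance : GeneralizedBooleanAlgebra (Idem M) where
  sdiff a b := emvCompl a (a ⊓ b)
  bot := 0
  sup_inf_sdiff _ _ := (sup_comm _ _).trans (compl_sup inf_le_left)
  inf_inf_sdiff _ _ := (inf_comm _ _).trans (compl_inf inf_le_left)

theorem compl_eq_sdiff {a x : Idem M} (hx : x ≤ a) : emvCompl a x = a \ x := by
  change _ = emvCompl a (a ⊓ x)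
  rw [inf_eq_right.2 hx]

end Idem
end
end EMVAlgebra

/-! ### The Loomis–Sikorski representation of generalized Boolean algebras -/

namespace LoomisSikorski

/-- Proper (possibly empty) filters of `B`. -/
def ProperFilter (B : Type u) [GeneralizedBooleanAlgebra B] : Type u :=
  {F : Set B // (∀ a ∈ F, ∀ b, a ≤ b → b ∈ F) ∧ (∀ a ∈ F, ∀ b ∈ F, a ⊓ b ∈ F) ∧ ⊥ ∉ F}

variable {B : Type u} [GeneralizedBooleanAlgebra B]

/-- Allowing the empty filter covers the case of trivial `B`. -/
instance : Nonempty (ProperFilter B) :=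
  ⟨⟨∅, fun _ h => h.elim, fun _ h => h.elim, fun h => h⟩⟩

/-- The filters containing `b`. -/
def basic (b : B) : Set (ProperFilter B) := {F | b ∈ F.1}

theorem basic_bot : basic (⊥ : B) = ∅ :=
  Set.eq_empty_of_forall_notMem fun F h => F.2.2.2 h

theorem basic_mono {a b : B} (h : a ≤ b) : basic a ⊆ basic b :=
  fun F hF => F.2.1 a hF b h

theorem basic_inf (a b : B) : basic (a ⊓ b) = basic a ∩ basic b :=
  Set.Subset.antisymm
    (Set.subset_inter (basic_mono inf_le_left) (basic_mono inf_le_right))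
    fun F hF => F.2.2.1 a hF.1 b hF.2

theorem notMem_basic_of_inf_eq_bot {F : ProperFilter B} {a b : B} (h : a ⊓ b = ⊥)
    (ha : F ∈ basic a) : F ∉ basic b := by
  intro hb
  have hab : F ∈ basic (a ⊓ b) := by
    rw [basic_inf]
    exact ⟨ha, hb⟩
  rw [h, basic_bot] at hab
  exact hab

/-- Only an inclusion: a non-maximal filter containing `a` may contain neither `b` nor `a \ b`. -/
theorem basic_sdiff_subset (a b : B) : basic (a \ b) ⊆ basic a \ basic b := by
  exact fun F hF => ⟨basic_mono sdiff_le hF,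
    notMem_basic_of_inf_eq_bot ((inf_comm _ _).trans inf_sdiff_self_right) hF⟩

/-- The σ-ideal generated by the sets of filters that fail to preserve some countable supremum. -/
def IsNull (A : Set (ProperFilter B)) : Prop :=
  ∃ (s : ℕ → B) (b : ℕ → ℕ → B), (∀ k, IsLUB (Set.range (b k)) (s k)) ∧
    A ⊆ ⋃ k, basic (s k) \ ⋃ n, basic (b k n)

theorem IsNull.mono {A A' : Set (ProperFilter B)} (h : IsNull A') (hA : A ⊆ A') : IsNull A := by
  obtain ⟨s, b, hs, hb⟩ := h
  exact ⟨s, b, hs, hA.trans hb⟩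

theorem IsNull.iUnion {A : ℕ → Set (ProperFilter B)} (h : ∀ n, IsNull (A n)) :
    IsNull (⋃ n, A n) := by
  choose s b hs hb using h
  refine ⟨fun k => s k.unpair.1 k.unpair.2, fun k => b k.unpair.1 k.unpair.2,
    fun k => hs _ _, Set.iUnion_subset fun n F hF => ?_⟩
  obtain ⟨k, hk⟩ := Set.mem_iUnion.1 (hb n hF)
  refine Set.mem_iUnion.2 ⟨Nat.pair n k, ?_⟩
  simpa only [Nat.unpair_pair] using hk

theorem IsNull.union {A A' : Set (ProperFilter B)} (h : IsNull A) (h' : IsNull A') :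
    IsNull (A ∪ A') := by
  refine (IsNull.iUnion (A := fun n => if n = 0 then A else A') fun n => ?_).mono ?_
  · by_cases hn : n = 0 <;> simpa [hn]
  · refine Set.union_subset (fun F hF => Set.mem_iUnion.2 ⟨0, ?_⟩)
      fun F hF => Set.mem_iUnion.2 ⟨1, ?_⟩ <;> simpa

theorem isNull_of_isLUB {b : ℕ → B} {s : B} (h : IsLUB (Set.range b) s) :
    IsNull (basic s \ ⋃ n, basic (b n)) :=
  ⟨fun _ => s, fun _ => b, fun _ => h, fun _ hF => Set.mem_iUnion.2 ⟨0, hF⟩⟩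

theorem isNull_empty : IsNull (∅ : Set (ProperFilter B)) :=
  (isNull_of_isLUB (b := fun _ => ⊥) (s := ⊥) (by simp)).mono (Set.empty_subset _)

/-- Treats a binary join as a countable one, so that finite joins need no separate null sets. -/
theorem isLUB_pair_seq (a b : B) :
    IsLUB (Set.range fun n : ℕ => if n = 0 then a else b) (a ⊔ b) := by
  constructor
  · rintro _ ⟨n, rfl⟩
    by_cases hn : n = 0 <;> simp [hn]
  · exact fun c hc => sup_le (by simpa using hc ⟨0, rfl⟩) (by simpa using hc ⟨1, rfl⟩)

theorem isNull_sup (a b : B) : IsNull (basic (a ⊔ b) \ (basic a ∪ basic b)) := by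
  refine (isNull_of_isLUB (isLUB_pair_seq a b)).mono
    (Set.sdiff_subset_sdiff_right (Set.iUnion_subset fun n => ?_))
  by_cases hn : n = 0 <;> simp [hn]

/-- If `c` missed every `b n`, then `s \ c` would be an upper bound, so `c` would miss `s`. -/
theorem exists_inf_ne_bot {b : ℕ → B} {s c : B} (h : IsLUB (Set.range b) s) (hc : c ⊓ s ≠ ⊥) :
    ∃ n, c ⊓ b n ≠ ⊥ := by
  by_contra! hb
  have h1 : s ≤ s \ c := by
    refine h.2 ?_
    rintro _ ⟨n, rfl⟩
    exact le_sdiff.2 ⟨h.1 ⟨n, rfl⟩, disjoint_iff.2 ((inf_comm _ _).trans (hb n))⟩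
  exact hc ((inf_comm _ _).trans (disjoint_iff.1 (le_sdiff.1 h1).2))

/-- A nonzero element lies in a proper filter preserving countably many given suprema. -/
theorem eq_bot_of_isNull_basic {c : B} (h : IsNull (basic c)) : c = ⊥ := by
  obtain ⟨s, b, hs, hb⟩ := h
  by_contra hc
  -- Each stage settles one supremum: shrink `x` to exclude `s k`, or to lie under some `b k n`.
  have step : ∀ (k : ℕ) (x : {x : B // x ≠ ⊥}), ∃ y : {x : B // x ≠ ⊥}, y.1 ≤ x.1 ∧
      (y.1 ⊓ s k = ⊥ ∨ ∃ n, y.1 ≤ b k n) := by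
    intro k x
    by_cases hx : x.1 ⊓ s k = ⊥
    · exact ⟨x, le_rfl, Or.inl hx⟩
    · obtain ⟨n, hn⟩ := exists_inf_ne_bot (hs k) hx
      exact ⟨⟨_, hn⟩, inf_le_left, Or.inr ⟨n, inf_le_right⟩⟩
  choose f hf1 hf2 using step
  let x : ℕ → {x : B // x ≠ ⊥} := fun n => Nat.rec ⟨c, hc⟩ f n
  have hx : Antitone fun n => (x n).1 := antitone_nat_of_succ_le fun n => hf1 n (x n)
  let F : ProperFilter B := ⟨{a | ∃ n, (x n).1 ≤ a},
    fun a ⟨n, hn⟩ b hab => ⟨n, hn.trans hab⟩,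
    fun a ⟨n, hn⟩ b ⟨m, hm⟩ => ⟨max n m,
      le_inf ((hx (le_max_left n m)).trans hn) ((hx (le_max_right n m)).trans hm)⟩,
    fun ⟨n, hn⟩ => (x n).2 (le_bot_iff.1 hn)⟩
  obtain ⟨k, hk⟩ := Set.mem_iUnion.1 (hb (show F ∈ basic c from ⟨0, le_rfl⟩))
  -- Requirement `k` is met in passing from `x k` to `x (k + 1)`.
  have hmem : (x (k + 1)).1 ∈ F.1 := ⟨k + 1, le_rfl⟩
  rcases hf2 k (x k) with h | ⟨n, hn⟩
  · exact notMem_basic_of_inf_eq_bot (F := F) h hmem hk.1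
  · exact hk.2 (Set.mem_iUnion.2 ⟨n, F.2.1 _ hmem _ hn⟩)

/-- `A` agrees with the basic set of `b` up to a null set. -/
def Represents (A : Set (ProperFilter B)) (b : B) : Prop :=
  IsNull (A \ basic b) ∧ IsNull (basic b \ A)

theorem represents_basic (b : B) : Represents (basic b) b := by
  simp [Represents, isNull_empty]

theorem represents_empty : Represents (∅ : Set (ProperFilter B)) ⊥ :=
  basic_bot (B := B) ▸ represents_basic ⊥

theorem Represents.mono {A A' : Set (ProperFilter B)} {a a' : B} (h : Represents A a)
    (h' : Represents A' a') (hA : A ⊆ A') : a ≤ a' := by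
  -- A filter containing `a \ a'` contains `a` but not `a'`, so it lies in one of the two error
  -- sets, according to whether it is in `A`.
  refine sdiff_eq_bot_iff.1 (eq_bot_of_isNull_basic ((h.2.union h'.1).mono ?_))
  intro F hF
  have h1 := basic_sdiff_subset a a' hF
  by_cases hFA : F ∈ A
  · exact Or.inr ⟨hA hFA, h1.2⟩
  · exact Or.inl ⟨h1.1, hFA⟩

theorem Represents.unique {A : Set (ProperFilter B)} {a a' : B} (h : Represents A a)
    (h' : Represents A a') : a = a' :=
  le_antisymm (h.mono h' subset_rfl) (h'.mono h subset_rfl)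

theorem Represents.iUnion {A : ℕ → Set (ProperFilter B)} {a : ℕ → B} {s : B}
    (h : ∀ n, Represents (A n) (a n)) (hs : IsLUB (Set.range a) s) :
    Represents (⋃ n, A n) s := by
  constructor
  · refine (IsNull.iUnion fun n => (h n).1).mono ?_
    rintro F ⟨hF, hFs⟩
    obtain ⟨n, hn⟩ := Set.mem_iUnion.1 hF
    exact Set.mem_iUnion.2 ⟨n, hn, fun h' => hFs (basic_mono (hs.1 ⟨n, rfl⟩) h')⟩
  · refine ((isNull_of_isLUB hs).union (IsNull.iUnion fun n => (h n).2)).mono ?_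
    rintro F ⟨hF, hFA⟩
    by_cases hFa : F ∈ ⋃ n, basic (a n)
    · obtain ⟨n, hn⟩ := Set.mem_iUnion.1 hFa
      exact Or.inr (Set.mem_iUnion.2 ⟨n, hn, fun h' => hFA (Set.mem_iUnion.2 ⟨n, h'⟩)⟩)
    · exact Or.inl ⟨hF, hFa⟩

theorem Represents.union {A A' : Set (ProperFilter B)} {a a' : B} (h : Represents A a)
    (h' : Represents A' a') : Represents (A ∪ A') (a ⊔ a') := by
  have h1 := Represents.iUnion (A := fun n => if n = 0 then A else A')
    (fun n => by by_cases hn : n = 0 <;> simpa [hn]) (isLUB_pair_seq a a')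
  convert h1 using 1
  refine Set.Subset.antisymm (Set.union_subset (fun F hF => Set.mem_iUnion.2 ⟨0, ?_⟩)
      fun F hF => Set.mem_iUnion.2 ⟨1, ?_⟩) (Set.iUnion_subset fun n => ?_)
  · simpa
  · simpa
  · by_cases hn : n = 0 <;> simp [hn]

theorem Represents.inter {A A' : Set (ProperFilter B)} {a a' : B} (h : Represents A a)
    (h' : Represents A' a') : Represents (A ∩ A') (a ⊓ a') := by
  constructor
  · refine (h.1.union h'.1).mono fun F hF => ?_
    rw [basic_inf] at hF
    simp only [Set.mem_union, Set.mem_sdiff, Set.mem_inter_iff] at hF ⊢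
    tauto
  · refine (h.2.union h'.2).mono fun F hF => ?_
    rw [basic_inf] at hF
    simp only [Set.mem_union, Set.mem_sdiff, Set.mem_inter_iff] at hF ⊢
    tauto

theorem Represents.sdiff {A A' : Set (ProperFilter B)} {a a' : B} (h : Represents A a)
    (h' : Represents A' a') : Represents (A \ A') (a \ a') := by
  constructor
  · refine ((h.1.union h'.2).union (isNull_sup (a \ a') (a ⊓ a'))).mono fun F hF => ?_
    rw [sup_comm (a \ a'), sup_inf_sdiff, basic_inf]
    simp only [Set.mem_union, Set.mem_sdiff, Set.mem_inter_iff] at hF ⊢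
    tauto
  · refine (h.2.union h'.1).mono fun F hF => ?_
    have h1 := basic_sdiff_subset a a' hF.1
    simp only [Set.mem_union, Set.mem_sdiff] at hF h1 ⊢
    tauto

/-- The σ-ring of all sets representing an element of `B`. -/
def sigmaRing (hB : ∀ a : ℕ → B, ∃ s, IsLUB (Set.range a) s) : SigmaRing (ProperFilter B) where
  carrier := {A | ∃ b, Represents A b}
  isSetRing :=
    { empty_mem := ⟨⊥, represents_empty⟩
      union_mem := fun _ _ ⟨_, h⟩ ⟨_, h'⟩ => ⟨_, h.union h'⟩
      sdiff_mem := fun _ _ ⟨_, h⟩ ⟨_, h'⟩ => ⟨_, h.sdiff h'⟩ }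
  iUnion_mem A hA := by
    choose a ha using hA
    obtain ⟨s, hs⟩ := hB a
    exact ⟨s, Represents.iUnion ha hs⟩

end LoomisSikorski

/-- The union itself belongs to the ring, so abstract suprema there are set-theoretic unions. -/
theorem SigmaRing.coe_isLUB {Ω : Type u} {R : SigmaRing Ω} {A : ℕ → R.Elem} {S : R.Elem}
    (h : IsLUB (Set.range A) S) : S.1 = ⋃ n, (A n).1 := by
  refine Set.Subset.antisymm ?_ (Set.iUnion_subset fun n => h.1 ⟨n, rfl⟩)
  refine h.2 (show (⟨_, R.iUnion_mem _ fun n => (A n).2⟩ : R.Elem) ∈ _ from ?_)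
  rintro _ ⟨n, rfl⟩
  exact Set.subset_iUnion (fun n => (A n).1) n

open LoomisSikorski in
theorem mainTheorem9 (M : Type u) [EMVAlgebra M] (hM : EMVAlgebra.IsSigmaComplete M) :
    ∃ (Ω : Type u) (_ : Nonempty Ω) (R : SigmaRing Ω) (φ : R.Elem → EMVAlgebra.Idem M),
      IsSigmaEMVHom φ ∧ Function.Surjective φ := by
  have hB := EMVAlgebra.Idem.exists_isLUB hM
  let φ : (sigmaRing hB).Elem → EMVAlgebra.Idem M := fun A => A.2.choose
  have hφ : ∀ A, Represents A.1 (φ A) := fun A => A.2.choose_spec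
  have hsup : ∀ X Y, φ (X ⊔ Y) = φ X ⊔ φ Y :=
    fun X Y => (hφ (X ⊔ Y)).unique ((hφ X).union (hφ Y))
  refine ⟨ProperFilter (EMVAlgebra.Idem M), inferInstance, sigmaRing hB, φ, ⟨⟨hsup, ?_, ?_, ?_, ?_⟩,
    ?_⟩, fun b => ⟨⟨basic b, b, represents_basic b⟩, (hφ _).unique (represents_basic b)⟩⟩
  · exact fun X Y => (hφ (X ⊓ Y)).unique ((hφ X).inter (hφ Y))
  · exact fun X Y => (hsup X Y).trans (EMVAlgebra.Idem.add_eq_sup _ _).symm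
  · exact (hφ 0).unique represents_empty
  · intro A _ X hX
    rw [EMVAlgebra.Idem.compl_eq_sdiff ((hφ X).mono (hφ A) hX)]
    refine (hφ _).unique ?_
    rw [SigmaRing.coe_compl A X hX]
    exact (hφ A).sdiff (hφ X)
  · intro X S hS
    obtain ⟨s, hs⟩ := hB fun n => φ (X n)
    have h := Represents.iUnion (fun n => hφ (X n)) hs
    rw [← SigmaRing.coe_isLUB hS] at h
    rwa [(hφ S).unique h]
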